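/- Let $d,m,m_0$ be natural numbers with $m_0\le m$. Let $\sigma:\mathbb R\to\mathbb R$ be a good activation, i.e. $\sigma$ is real analytic on $\mathbb R$ and its power series $\sigma(x)=\sum_{j\ge 0}c_jx^j$ at $0$ (valid on $(-\rho,\rho)$, where $\rho\in(0,\infty]$ is its radius of convergence) satisfies $c_0\neq 0$, and for every $N$ there are an odd $j>N$ and an even $j'>N$ with $c_j\ne 0$ and $c_{j'}\neq 0$. Let $f^*:\mathbb R^d\to\mathbb R$, $f^*(x)=\sum_{k=1}^{m_0}\bar a_k\sigma(\bar w_k\cdot x)$, where $\bar a_k\in\mathbb R\setminus\{0\}$ and the $\bar w_k\in\mathbb R^d$ are pairwise distinct. For $\theta=(a_1,w_1,\dots,a_m,w_m)\in(\mathbb R\times\mathbb R^d)^m=\mathbb R^{(d+1)m}$ (with the Euclidean norm) put $g(\theta,x)=\sum_{k=1}^m a_k\sigma(w_k\cdot x)$, and let $$Q^*=\{\theta\in\mathbb R^{(d+1)m}: g(\theta,\cdot)=f^*\}.$$ For points $x_1,\dots,x_n\in\mathbb R^d$ put $R_{x_1,\dots,x_n}(\theta)=\sum_{i=1}^n|g(\theta,x_i)-f^*(x_i)|^2$.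 Then the following hold. (a) For every $N\in\mathbb N$ and every open $O\subseteq\mathbb R^{(d+1)m}$ with $Q^*\subseteq O$, there are finitely many pairwise distinct points $x_1,\dots,x_n\in\mathbb R^d$ ($n\ge 1$) such that $\{\theta:\|\theta\|\le N\}\cap R_{x_1,\dots,x_n}^{-1}\{0\}\subseteq O$. (b) For every $n>(d+1)m$, all pairwise distinct $x_1,\dots,x_n\in\mathbb R^d$ and every $\varepsilon>0$, there are pairwise distinct $x_1',\dots,x_n'\in\mathbb R^d$ with $\|x_i'-x_i\|\le\varepsilon$ for all $i$ such that $R_{x_1',\dots,x_n'}^{-1}\{0\}=Q^*$. -/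

import Mathlib

/-- The input space `ℝᵈ` with the Euclidean inner product. -/
abbrev InputSpace (d : ℕ) : Type := EuclideanSpace ℝ (Fin d)

/-- The parameter space `ℝ^{(d+1)m}` with the Euclidean norm. The coordinates of
`θ = (a₁, w₁, …, aₘ, wₘ)` are indexed by `Fin m × Fin (d + 1)`: the coordinate `(k, 0)` is `aₖ`
and the coordinates `(k, 1), …, (k, d)` are those of `wₖ`. -/
abbrev ParamSpace (d m : ℕ) : Type := EuclideanSpace ℝ (Fin m × Fin (d + 1))

/-- The output weights `aₖ` of a parameter `θ`. -/
def outputWeight {d m : ℕ} (θ : ParamSpace d m) (k : Fin m) : ℝ := θ (k, 0)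

/-- The input weights `wₖ ∈ ℝᵈ` of a parameter `θ`. -/
def inputWeight {d m : ℕ} (θ : ParamSpace d m) (k : Fin m) : InputSpace d :=
  WithLp.toLp 2 fun j : Fin d => θ (k, j.succ)

/-- A good activation: a real analytic `σ : ℝ → ℝ` whose power series `∑ cⱼ xʲ` at `0`
(representing `σ` on the interval given by its radius of convergence) has `c₀ ≠ 0`, infinitely many
nonzero coefficients of odd index and infinitely many nonzero coefficients of even index. -/
def IsGoodActivation (σ : ℝ → ℝ) : Prop :=
  AnalyticOnNhd ℝ σ Set.univ ∧
  ∃ c : ℕ → ℝ,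
    HasFPowerSeriesOnBall σ (FormalMultilinearSeries.ofScalars ℝ c) 0
      (FormalMultilinearSeries.ofScalars ℝ c).radius ∧
    c 0 ≠ 0 ∧
    (∀ N : ℕ, ∃ j : ℕ, N < j ∧ Odd j ∧ c j ≠ 0) ∧
    (∀ N : ℕ, ∃ j : ℕ, N < j ∧ Even j ∧ c j ≠ 0)

/-- The function `x ↦ ∑ₖ aₖ σ(wₖ · x)`. -/
noncomputable def neuronSum {d r : ℕ} (σ : ℝ → ℝ) (a : Fin r → ℝ) (w : Fin r → InputSpace d)
    (x : InputSpace d) : ℝ :=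
  ∑ k : Fin r, a k * σ (inner ℝ (w k) x)

/-- The two-layer network `g(θ, x) = ∑ₖ aₖ σ(wₖ · x)` of width `m`. -/
noncomputable def network {d m : ℕ} (σ : ℝ → ℝ) (θ : ParamSpace d m) (x : InputSpace d) : ℝ :=
  neuronSum σ (outputWeight θ) (inputWeight θ) x

/-- The empirical loss `R(θ) = ∑ᵢ |g(θ, xᵢ) - f(xᵢ)|²` at the samples `(xᵢ, f(xᵢ))`. -/
noncomputable def empiricalLoss {d m n : ℕ} (σ : ℝ → ℝ) (f : InputSpace d → ℝ)
    (x : Fin n → InputSpace d) (θ : ParamSpace d m) : ℝ :=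
  ∑ i : Fin n, |network σ θ (x i) - f (x i)| ^ 2

/-- The set `Q*` of the parameters of width `m` with `g(θ, ·) = f`. -/
def exactParams {d : ℕ} (m : ℕ) (σ : ℝ → ℝ) (f : InputSpace d → ℝ) : Set (ParamSpace d m) :=
  {θ | network σ θ = f}

/-! Part (a) is compactness: each parameter of the ball outside `O` is excluded by some sample
point, and finitely many points suffice. Part (b) is a dimension count for `F (θ, x) = g(θ, x) -
f*(x)`. Call a tuple bad if some `θ` with `F (θ, ·) ≠ 0` vanishes at all its points. By analyticity
each such zero is a noncritical zero of an iterated derivative in one of countably many directions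
(`exists_iteratedDirDeriv_eq_zero_ne_zero`). So the pairs `(θ, X)` fall into countably many sets cut
out by `n` independent equations (`dimH_le_of_regular_zeros`). As `n > dim Θ`, their projections to
the tuples have Hausdorff dimension below the full one, and the good tuples are dense. -/

open Set Filter Topology Module in
/-- The zero set of a map, at points where it is strictly differentiable with surjective derivative,
has Hausdorff dimension at most the difference of the dimensions. -/
theorem dimH_le_of_regular_zeros {E F : Type*} [NormedAddCommGroup E] [NormedSpace ℝ E]
    [FiniteDimensional ℝ E] [NormedAddCommGroup F] [NormedSpace ℝ F] [FiniteDimensional ℝ F]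
    {G : E → F} {S : Set E} (hG : ∀ p ∈ S, G p = 0)
    (h : ∀ p ∈ S, ∃ G' : E →L[ℝ] F, HasStrictFDerivAt G G' p ∧ Function.Surjective G') :
    dimH S ≤ ((finrank ℝ E - finrank ℝ F : ℕ) : ENNReal) := by
  by_contra! hlt
  have : SecondCountableTopology E := by
    have := FiniteDimensional.proper_real E
    infer_instance
  obtain ⟨p, hp, hdim⟩ := exists_mem_nhdsWithin_lt_dimH_of_lt_dimH hlt
  obtain ⟨G', hG', hsurj⟩ := h p hp
  obtain ⟨R, hR⟩ := G'.exists_rightInverse_of_surjective (LinearMap.range_eq_top.2 hsurj)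
  have hR' (y : F) : G' (R y) = y := DFunLike.congr_fun hR y
  -- The projection onto the kernel along the range of `R`.
  let P : E →L[ℝ] G'.ker :=
    (ContinuousLinearMap.id ℝ E - R ∘L G').codRestrict G'.ker fun x => by simp [hR']
  have hc : (0 : ℝ) < 1 / (2 * (‖R‖ + 1)) := by positivity
  obtain ⟨t, ht, htG⟩ : ∃ t ∈ 𝓝 p, ∀ x ∈ t, ∀ y ∈ t,
      ‖G x - G y - G' (x - y)‖ ≤ 1 / (2 * (‖R‖ + 1)) * ‖x - y‖ := by
    have := hG'.isLittleO.def hc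
    rw [nhds_prod_eq, Filter.Eventually, mem_prod_same_iff] at this
    obtain ⟨t, ht, H⟩ := this
    exact ⟨t, ht, fun x hx y hy => H (mk_mem_prod hx hy)⟩
  -- For two zeros of `G` near `p`, strict differentiability makes `G' (x - y)` small, so the kernel
  -- component controls `x - y`.
  have hanti : AntilipschitzWith 2 fun x : ↥(S ∩ t) => P x := by
    refine AntilipschitzWith.of_le_mul_dist fun x y => ?_
    have h1 := htG x x.2.2 y y.2.2
    rw [hG _ x.2.1, hG _ y.2.1, sub_self, zero_sub, norm_neg] at h1
    have h2 : ((x : E) - y) = (P (x - y) : E) + R (G' (x - y)) := by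
      simp only [P, ContinuousLinearMap.coe_codRestrict_apply, sub_apply,
        ContinuousLinearMap.id_apply, ContinuousLinearMap.comp_apply, sub_add_cancel]
    have h3 : ‖(x : E) - y‖ ≤ ‖P (x - y)‖ + ‖R‖ * ‖G' ((x : E) - y)‖ := by
      calc ‖(x : E) - y‖ ≤ ‖(P (x - y) : E)‖ + ‖R (G' ((x : E) - y))‖ := by
            conv_lhs => rw [h2]
            exact norm_add_le _ _
        _ ≤ _ := add_le_add le_rfl (R.le_opNorm _)
    have h4 : ‖R‖ * ‖G' ((x : E) - y)‖ ≤ 1 / 2 * ‖(x : E) - y‖ := by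
      calc _ ≤ (‖R‖ + 1) * (1 / (2 * (‖R‖ + 1)) * ‖(x : E) - y‖) := by gcongr; linarith
        _ = _ := by field_simp
    rw [Subtype.dist_eq, dist_eq_norm, dist_eq_norm, ← map_sub]
    push_cast
    linarith
  have h5 := hanti.le_dimH_image univ
  have h6 : dimH (univ : Set ↥(S ∩ t)) = dimH (S ∩ t) := by
    rw [← isometry_subtype_coe.dimH_image univ, image_univ, Subtype.range_coe]
  have h7 : finrank ℝ G'.ker = finrank ℝ E - finrank ℝ F := by
    have h8 := LinearMap.finrank_range_add_finrank_ker (G' : E →ₗ[ℝ] F)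
    rw [LinearMap.range_eq_top.2 hsurj, finrank_top] at h8
    change finrank ℝ (LinearMap.ker (G' : E →ₗ[ℝ] F)) = _
    omega
  have h9 : dimH (univ : Set G'.ker) = finrank ℝ G'.ker := Real.dimH_univ_eq_finrank _
  have h10 := hdim (S ∩ t) (inter_mem self_mem_nhdsWithin (mem_nhdsWithin_of_mem_nhds ht))
  rw [← h7, ← h9, ← h6] at h10
  exact absurd (h10.trans_le (h5.trans (dimH_mono (subset_univ _)))) (lt_irrefl _)

/-- The `k`-th derivative of `f` in the constant direction `v`. -/
noncomputable def iteratedDirDeriv {E : Type*} [NormedAddCommGroup E] [NormedSpace ℝ E] (v : E)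
    (f : E → ℝ) : ℕ → E → ℝ
  | 0 => f
  | k + 1 => fun p => fderiv ℝ (iteratedDirDeriv v f k) p v

open scoped ContDiff in
theorem ContDiff.iteratedDirDeriv {E : Type*} [NormedAddCommGroup E] [NormedSpace ℝ E] (v : E)
    {f : E → ℝ} (hf : ContDiff ℝ ∞ f) (k : ℕ) : ContDiff ℝ ∞ (iteratedDirDeriv v f k) := by
  induction k with
  | zero => exact hf
  | succ k ih =>
    exact (ih.fderiv_right (m := ∞) (by simp)).clm_apply contDiff_const

open scoped ContDiff in
theorem iteratedDeriv_comp_line {E : Type*} [NormedAddCommGroup E] [NormedSpace ℝ E] (p v : E)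
    {f : E → ℝ} (hf : ContDiff ℝ ∞ f) (k : ℕ) :
    iteratedDeriv k (fun t : ℝ => f (p + t • v)) = fun t => iteratedDirDeriv v f k (p + t • v) := by
  induction k with
  | zero => simp [iteratedDirDeriv]
  | succ k ih =>
    rw [iteratedDeriv_succ, ih]
    funext t
    have h1 : HasDerivAt (fun t : ℝ => p + t • v) v t := by
      simpa using ((hasDerivAt_id t).smul_const v).const_add p
    exact (((hf.iteratedDirDeriv v k).differentiable (by simp)
      (p + t • v)).hasFDerivAt.comp_hasDerivAt t h1).deriv

theorem AnalyticOnNhd.eq_zero_of_iteratedDeriv {φ : ℝ → ℝ} (hφ : AnalyticOnNhd ℝ φ Set.univ)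
    (h : ∀ k, iteratedDeriv k φ 0 = 0) : φ = 0 := by
  have h1 : analyticOrderAt φ 0 = ⊤ := by
    refine ENat.eq_top_iff_forall_ge.2 fun n => ?_
    exact (natCast_le_analyticOrderAt_iff_iteratedDeriv_eq_zero (hφ 0 trivial)).2 fun i _ => h i
  funext t
  exact hφ.eqOn_zero_of_preconnected_of_eventuallyEq_zero isPreconnected_univ (Set.mem_univ 0)
    (analyticOrderAt_eq_top.1 h1) (Set.mem_univ t)

open scoped ContDiff in
/-- A zero of a function that is nonzero and analytic along lines is a noncritical zero of one of
its iterated directional derivatives, with the direction in a given dense set. -/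
theorem exists_iteratedDirDeriv_eq_zero_ne_zero {Θ V : Type*} [NormedAddCommGroup Θ]
    [NormedSpace ℝ Θ] [NormedAddCommGroup V] [NormedSpace ℝ V] {F : Θ × V → ℝ}
    (hF : ContDiff ℝ ∞ F)
    (hline : ∀ θ x v, AnalyticOnNhd ℝ (fun t : ℝ => F (θ, x + t • v)) Set.univ)
    {D : ℕ → V} (hD : DenseRange D) {θ : Θ} {x : V} (hx : F (θ, x) = 0)
    (hne : ∃ y, F (θ, y) ≠ 0) :
    ∃ j k, iteratedDirDeriv (0, D j) F k (θ, x) = 0 ∧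
      iteratedDirDeriv (0, D j) F (k + 1) (θ, x) ≠ 0 := by
  by_contra! H
  obtain ⟨y, hy⟩ := hne
  refine hy ?_
  have hcont : Continuous fun v => F (θ, x + v) := hF.continuous.comp (by fun_prop)
  have hzero : (fun v => F (θ, x + v)) = fun _ => 0 := by
    -- Otherwise all derivatives along each `D j` vanish at `x`, hence `F (θ, ·)` vanishes at the
    -- dense points `x + D j` (time `1` on each line).
    refine hD.equalizer hcont continuous_const (funext fun j => ?_)
    have hall (k : ℕ) : iteratedDirDeriv (0, D j) F k (θ, x) = 0 := by
      induction k with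
      | zero => exact hx
      | succ k ih => exact H j k ih
    have hl : (fun t : ℝ => F (θ, x + t • D j)) = fun t : ℝ => F ((θ, x) + t • (0, D j)) := by
      simp
    have := (hline θ x (D j)).eq_zero_of_iteratedDeriv fun k => by
      rw [hl, iteratedDeriv_comp_line _ _ hF]
      simpa using hall k
    simpa using congrFun this 1
  simpa using congrFun hzero (y - x)

open scoped ContDiff in
open Module Set in
/-- If `n` exceeds the number of parameters of a family of functions analytic along lines, then for
a dense set of `n`-tuples of points, a member of the family that vanishes at these points is
zero. -/
theorem dense_determining_points {Θ V : Type*} [NormedAddCommGroup Θ]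
    [NormedSpace ℝ Θ] [FiniteDimensional ℝ Θ] [NormedAddCommGroup V] [NormedSpace ℝ V]
    [FiniteDimensional ℝ V] {F : Θ × V → ℝ} (hF : ContDiff ℝ ∞ F)
    (hline : ∀ θ x v, AnalyticOnNhd ℝ (fun t : ℝ => F (θ, x + t • v)) univ)
    {n : ℕ} (hn : finrank ℝ Θ < n) :
    Dense {X : Fin n → V | ∀ θ, (∀ i, F (θ, X i) = 0) → ∀ y, F (θ, y) = 0} := by
  have : SecondCountableTopology V := by
    have := FiniteDimensional.proper_real V
    infer_instance
  set T := {X : Fin n → V | ∀ θ, (∀ i, F (θ, X i) = 0) → ∀ y, F (θ, y) = 0} with hT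
  -- In dimension zero no dimension can be strictly smaller; there all points coincide.
  rcases Nat.eq_zero_or_pos (finrank ℝ V) with hV | hV
  · have : Subsingleton V := finrank_zero_iff.1 hV
    have : T = univ := eq_univ_of_forall fun X θ h y => by
      rw [Subsingleton.elim y (X ⟨0, by omega⟩)]
      exact h _
    rw [this]
    exact dense_univ
  let D := TopologicalSpace.denseSeq V
  let H : ℕ × ℕ → ℕ → Θ × V → ℝ := fun b l => iteratedDirDeriv (0, D b.1) F (b.2 + l)
  let S : (Fin n → ℕ × ℕ) → Set (Θ × (Fin n → V)) := fun β =>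
    {p | ∀ i, H (β i) 0 (p.1, p.2 i) = 0 ∧ H (β i) 1 (p.1, p.2 i) ≠ 0}
  have hsub : Tᶜ ⊆ ⋃ β, Prod.snd '' S β := by
    intro X hX
    simp only [hT, mem_compl_iff, mem_ofPred_eq, not_forall] at hX
    obtain ⟨θ, h0, hne⟩ := hX
    choose j k hjk using fun i => exists_iteratedDirDeriv_eq_zero_ne_zero hF hline
      (TopologicalSpace.denseRange_denseSeq V) (h0 i) hne
    exact mem_iUnion.2 ⟨fun i => (j i, k i), (θ, X), hjk, rfl⟩
  have hdim (β : Fin n → ℕ × ℕ) :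
      dimH (Prod.snd '' S β) ≤ ((finrank ℝ (Θ × (Fin n → V)) - n : ℕ) : ENNReal) := by
    refine (LipschitzWith.prod_snd.dimH_image_le _).trans ?_
    have hsmooth (i : Fin n) : ContDiff ℝ ∞ (H (β i) 0) := hF.iteratedDirDeriv _ _
    let q (i : Fin n) : Θ × (Fin n → V) →L[ℝ] Θ × V :=
      (ContinuousLinearMap.fst ℝ Θ (Fin n → V)).prod
        ((ContinuousLinearMap.proj i).comp (ContinuousLinearMap.snd ℝ Θ (Fin n → V)))
    have := dimH_le_of_regular_zeros (S := S β) (G := fun p i => H (β i) 0 (q i p))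
      (fun p hp => funext fun i => (hp i).1) fun p hp =>
      ⟨ContinuousLinearMap.pi fun i => (fderiv ℝ (H (β i) 0) (q i p)).comp (q i),
        hasStrictFDerivAt_pi.2 fun i =>
          (((hsmooth i).contDiffAt.hasStrictFDerivAt (by simp)).comp p (q i).hasStrictFDerivAt),
        -- The `i`-th equation involves only the `i`-th point, so moving that point along its own
        -- direction adjusts the `i`-th component alone.
        fun c => ⟨(0, fun i => (c i / H (β i) 1 (q i p)) • D (β i).1), funext fun i => ?_⟩⟩
    · simpa using this
    · have h1 : q i (0, fun i => (c i / H (β i) 1 (q i p)) • D (β i).1) =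
          (c i / H (β i) 1 (q i p)) • ((0, D (β i).1) : Θ × V) := by simp [q]
      have h2 : fderiv ℝ (H (β i) 0) (q i p) (0, D (β i).1) = H (β i) 1 (q i p) := rfl
      rw [ContinuousLinearMap.pi_apply, ContinuousLinearMap.comp_apply, h1, map_smul, h2,
        smul_eq_mul]
      exact div_mul_cancel₀ _ (hp i).2
  have hlt : dimH Tᶜ < finrank ℝ (Fin n → V) := by
    calc dimH Tᶜ ≤ dimH (⋃ β, Prod.snd '' S β) := dimH_mono hsub
      _ = ⨆ β, dimH (Prod.snd '' S β) := dimH_iUnion _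
      _ ≤ ((finrank ℝ (Θ × (Fin n → V)) - n : ℕ) : ENNReal) := iSup_le hdim
      _ < _ := by
        have : 0 < n * finrank ℝ V := Nat.mul_pos (by omega) hV
        rw [finrank_prod, finrank_pi_fintype, Finset.sum_const, Finset.card_univ, Fintype.card_fin,
          smul_eq_mul]
        exact_mod_cast (by omega : finrank ℝ Θ + n * finrank ℝ V - n < n * finrank ℝ V)
  simpa using dense_compl_of_dimH_lt_finrank hlt

theorem inner_inputWeight {d m : ℕ} (θ : ParamSpace d m) (k : Fin m) (x : InputSpace d) :
    inner ℝ (inputWeight θ k) x = ∑ j, θ (k, j.succ) * x j := by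
  simp [inputWeight, PiLp.inner_apply, mul_comm]

theorem contDiff_network {d m : ℕ} {σ : ℝ → ℝ} {r : WithTop ℕ∞} (hσ : ContDiff ℝ r σ) :
    ContDiff ℝ r fun p : ParamSpace d m × InputSpace d => network σ p.1 p.2 := by
  simp only [network, neuronSum, inner_inputWeight, outputWeight]
  exact ContDiff.sum fun k _ => ContDiff.mul (by fun_prop) (hσ.comp (by fun_prop))

theorem contDiff_neuronSum {d r : ℕ} {σ : ℝ → ℝ} {s : WithTop ℕ∞} (hσ : ContDiff ℝ s σ)
    (a : Fin r → ℝ) (w : Fin r → InputSpace d) : ContDiff ℝ s (neuronSum σ a w) := by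
  unfold neuronSum
  exact ContDiff.sum fun k _ => contDiff_const.mul
    (hσ.comp (contDiff_const.inner ℝ contDiff_id))

theorem analyticOnNhd_neuronSum_line {d r : ℕ} {σ : ℝ → ℝ} (hσ : AnalyticOnNhd ℝ σ Set.univ)
    (a : Fin r → ℝ) (w : Fin r → InputSpace d) (x v : InputSpace d) :
    AnalyticOnNhd ℝ (fun t : ℝ => neuronSum σ a w (x + t • v)) Set.univ := by
  simp only [neuronSum, inner_add_right, inner_smul_right]
  refine Finset.analyticOnNhd_fun_sum _ fun k _ => analyticOnNhd_const.mul ?_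
  exact hσ.comp (fun t _ => by fun_prop) (Set.mapsTo_univ _ _)

theorem empiricalLoss_eq_zero_iff {d m n : ℕ} {σ : ℝ → ℝ} {f : InputSpace d → ℝ}
    {x : Fin n → InputSpace d} {θ : ParamSpace d m} :
    empiricalLoss σ f x θ = 0 ↔ ∀ i, network σ θ (x i) = f (x i) := by
  rw [empiricalLoss, Finset.sum_eq_zero_iff_of_nonneg fun i _ => by positivity]
  simp [sub_eq_zero]

theorem isOpen_setOf_injective {ι X : Type*} [Finite ι] [TopologicalSpace X] [T2Space X] :
    IsOpen {f : ι → X | Function.Injective f} := by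
  have : {f : ι → X | Function.Injective f} = ⋂ (i) (j) (_ : i ≠ j), {f | f i ≠ f j} := by
    ext f
    simp [Function.Injective, not_imp_not]
  rw [this]
  exact isOpen_iInter_of_finite fun i => isOpen_iInter_of_finite fun j =>
    isOpen_iInter_of_finite fun _ => isOpen_ne_fun (continuous_apply i) (continuous_apply j)

theorem exists_samples_closedBall_inter_zeros_subset {d m : ℕ} {σ : ℝ → ℝ} (hσ : Continuous σ)
    (f : InputSpace d → ℝ) (N : ℝ) {O : Set (ParamSpace d m)} (hO : IsOpen O)
    (hQ : exactParams m σ f ⊆ O) :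
    ∃ (n : ℕ) (x : Fin n → InputSpace d), 1 ≤ n ∧ Function.Injective x ∧
      Metric.closedBall 0 N ∩ empiricalLoss σ f x ⁻¹' {0} ⊆ O := by
  have hK : IsCompact (Metric.closedBall (0 : ParamSpace d m) N \ O) :=
    (isCompact_closedBall 0 N).diff hO
  have hcont (x : InputSpace d) : Continuous fun θ : ParamSpace d m => network σ θ x :=
    (contDiff_network (r := 0) (contDiff_zero.2 hσ)).continuous.comp
      (Continuous.prodMk_left x)
  obtain ⟨t, ht⟩ := hK.elim_finite_subcover (fun x => {θ | network σ θ x ≠ f x})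
    (fun x => isOpen_ne_fun (hcont x) continuous_const) fun θ hθ => by
      have : network σ θ ≠ f := fun h => hθ.2 (hQ h)
      obtain ⟨x, hx⟩ := Function.ne_iff.1 this
      exact Set.mem_iUnion.2 ⟨x, hx⟩
  classical
  -- Inserting `0` ensures `1 ≤ n` even if the subcover is empty.
  refine ⟨_, fun i => ((insert 0 t).equivFin.symm i : InputSpace d),
    Finset.card_pos.2 (Finset.insert_nonempty 0 t),
    Subtype.val_injective.comp (Equiv.injective _), fun θ ⟨hθ, hR⟩ => ?_⟩
  by_contra hθO
  obtain ⟨x, hxt, hx⟩ := Set.mem_iUnion₂.1 (ht ⟨hθ, hθO⟩)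
  have := empiricalLoss_eq_zero_iff.1 hR
    ((insert 0 t).equivFin ⟨x, Finset.mem_insert_of_mem hxt⟩)
  simp only [Equiv.symm_apply_apply] at this
  exact hx this

open scoped ContDiff in
theorem dense_samples_zeros_eq_exactParams {d m r n : ℕ} {σ : ℝ → ℝ}
    (hσ : AnalyticOnNhd ℝ σ Set.univ) (a : Fin r → ℝ) (w : Fin r → InputSpace d)
    (hn : (d + 1) * m < n) :
    Dense {x : Fin n → InputSpace d |
      empiricalLoss σ (neuronSum σ a w) x ⁻¹' {0} = exactParams m σ (neuronSum σ a w)} := by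
  have hsmooth : ContDiff ℝ ∞ σ := contDiff_iff_contDiffAt.2 fun x => (hσ x trivial).contDiffAt
  have hF : ContDiff ℝ ∞ fun p : ParamSpace d m × InputSpace d =>
      network σ p.1 p.2 - neuronSum σ a w p.2 :=
    (contDiff_network hsmooth).sub ((contDiff_neuronSum hsmooth a w).comp contDiff_snd)
  refine (dense_determining_points hF (fun θ x v =>
    (analyticOnNhd_neuronSum_line hσ (outputWeight θ) (inputWeight θ) x v).sub
      (analyticOnNhd_neuronSum_line hσ a w x v))
    (n := n) ?_).mono fun x hx => ?_
  · rw [finrank_euclideanSpace, Fintype.card_prod, Fintype.card_fin, Fintype.card_fin, mul_comm]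
    exact hn
  · ext θ
    refine empiricalLoss_eq_zero_iff.trans ⟨fun h => funext fun y => ?_, fun h i => congrFun h _⟩
    exact sub_eq_zero.1 (hx θ (fun i => sub_eq_zero.2 (h i)) y)

theorem mainTheorem5 (d m m₀ : ℕ) (hm : m₀ ≤ m)
    (σ : ℝ → ℝ) (hσ : IsGoodActivation σ)
    (a : Fin m₀ → ℝ) (w : Fin m₀ → InputSpace d)
    (ha : ∀ k, a k ≠ 0) (hw : Function.Injective w) :
    (∀ (N : ℕ) (O : Set (ParamSpace d m)), IsOpen O →
      exactParams m σ (neuronSum σ a w) ⊆ O →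
      ∃ (n : ℕ) (x : Fin n → InputSpace d), 1 ≤ n ∧ Function.Injective x ∧
        Metric.closedBall (0 : ParamSpace d m) (N : ℝ) ∩
          empiricalLoss σ (neuronSum σ a w) x ⁻¹' {0} ⊆ O) ∧
    (∀ (n : ℕ) (x : Fin n → InputSpace d), (d + 1) * m < n → Function.Injective x →
      ∀ ε : ℝ, 0 < ε →
      ∃ x' : Fin n → InputSpace d, Function.Injective x' ∧ (∀ i, dist (x' i) (x i) ≤ ε) ∧
        empiricalLoss σ (neuronSum σ a w) x' ⁻¹' {0} =
          exactParams m σ (neuronSum σ a w)) := by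
  refine ⟨fun N O hO hQ => exists_samples_closedBall_inter_zeros_subset
    (continuousOn_univ.1 hσ.1.continuousOn) _ N hO hQ, fun n x hn hx ε hε => ?_⟩
  -- Tuples carry the sup metric, so this ball bounds every displacement at once.
  have hU : IsOpen (Metric.ball x ε ∩ {y | Function.Injective y}) :=
    Metric.isOpen_ball.inter isOpen_setOf_injective
  obtain ⟨x', hx', hQ⟩ := (dense_samples_zeros_eq_exactParams hσ.1 a w hn).inter_open_nonempty _ hU
    ⟨x, Metric.mem_ball_self hε, hx⟩
  exact ⟨x', hx'.2, fun i => (dist_le_pi_dist x' x i).trans (Metric.mem_ball.1 hx'.1).le, hQ⟩
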